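/- All graphs are countable, connected, locally finite and simple. A rooted graph is a pair $(G,\rho)$ with $\rho$ a vertex of $G$, and $B_G(\rho,r)$ is the subgraph of $G$ induced by the vertices at graph distance at most $r$ from $\rho$. Let $\mathcal G_\bullet$ be the set of isomorphism classes of rooted graphs (isomorphisms preserve the root), with the distance $$d_{\mathrm{loc}}\big((G_1,\rho_1),(G_2,\rho_2)\big)=\inf\Big\{\tfrac1{r+1}: r\ge 0,\ (B_{G_1}(\rho_1,r),\rho_1)\simeq (B_{G_2}(\rho_2,r),\rho_2)\Big\}$$ and its Borel $\sigma$-algebra. A random rooted graph is a random variable $(G,\rho)$ with values in $\mathcal G_\bullet$. It is called stationary if for every $n\ge 1$ the rooted graph $(G,X_n)$ has the same distribution as $(G,\rho)$, where, conditionally on $(G,\rho)$, $(X_n)_{n\ge 0}$ is the simple random walk on $G$ started at $\rho$ (on the graph with a single vertex the walk stays put). A function $f:V(G)\to\mathbb R$ is harmonic if its value at every vertex is the average of its values at the neighbours of that vertex, and $G$ is Liouville if every bounded harmonic function on $G$ is constant. **Theorem 1.1.** Let $(G,\rho)$ be a stationary random graph of subexponential growth, in the sense that $$\frac1n\,\mathbf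 E\big[\log \#B_G(\rho,n)\big]\xrightarrow[n\to\infty]{}0,$$ where $\#B_G(\rho,n)$ is the number of vertices of $G$ within distance $n$ from $\rho$. Then $(G,\rho)$ is almost surely Liouville. -/

import Mathlib

open MeasureTheory Filter Topology
open scoped ENNReal

/-- A rooted graph `(G, ρ)`: a countable, connected, locally finite, simple graph with a
distinguished vertex. -/
structure RootedGraph : Type 1 where
  /-- the vertex set -/
  V : Type
  /-- the graph (Mathlib's simple graphs have no loops and no multiple edges) -/
  graph : SimpleGraph V
  /-- the root -/
  root : V
  countable : Countable V
  connected : graph.Connected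
  locallyFinite : ∀ v, (graph.neighborSet v).Finite

namespace RootedGraph

/-- The finite set of neighbours of a vertex. -/
noncomputable def nbrs (G : RootedGraph) (v : G.V) : Finset G.V :=
  (G.locallyFinite v).toFinset

theorem mem_nbrs {G : RootedGraph} {v w : G.V} : w ∈ G.nbrs v ↔ G.graph.Adj v w := by
  simp [nbrs]

/-- The same graph with another root. -/
def reroot (G : RootedGraph) (x : G.V) : RootedGraph :=
  { G with root := x }

/-- The rooted graphs `G` and `H` are isomorphic. -/
def Iso (G H : RootedGraph) : Prop :=
  ∃ e : G.graph ≃g H.graph, e G.root = H.root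

/-- The vertices at graph distance at most `r` from the root. -/
def ball (G : RootedGraph) (r : ℕ) : Set G.V :=
  {v | G.graph.dist G.root v ≤ r}

theorem root_mem_ball (G : RootedGraph) (r : ℕ) : G.root ∈ G.ball r := by
  simp [ball]

theorem exists_adj_of_dist_succ (G : RootedGraph) {s : ℕ} {v : G.V}
    (h : G.graph.dist G.root v = s + 1) :
    ∃ u, G.graph.Adj u v ∧ G.graph.dist G.root u ≤ s := by
  obtain ⟨p, hp⟩ := G.connected.exists_walk_length_eq_dist v G.root
  rw [SimpleGraph.dist_comm, h] at hp
  cases p with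
  | nil => simp at hp
  | cons hadj q =>
    refine ⟨_, hadj.symm, ?_⟩
    rw [SimpleGraph.dist_comm]
    refine (SimpleGraph.dist_le q).trans ?_
    simp at hp
    omega

theorem dist_le_succ_of_adj (G : RootedGraph) {s : ℕ} {u v : G.V} (h : G.graph.Adj u v)
    (hu : G.graph.dist G.root u ≤ s) : G.graph.dist G.root v ≤ s + 1 := by
  have h1 := G.connected.dist_triangle (u := G.root) (v := u) (w := v)
  have h2 := SimpleGraph.dist_le h.toWalk
  simp at h2
  omega

theorem ball_finite (G : RootedGraph) (r : ℕ) : (G.ball r).Finite := by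
  induction r with
  | zero =>
    refine (Set.finite_singleton G.root).subset fun v hv => ?_
    have h0 : G.graph.dist G.root v = 0 := Nat.le_zero.mp hv
    exact (G.connected.dist_eq_zero_iff.mp h0).symm
  | succ s ih =>
    refine (ih.union (ih.biUnion fun u _ => G.locallyFinite u)).subset fun v hv => ?_
    rcases Nat.lt_or_ge (G.graph.dist G.root v) (s + 1) with h | h
    · exact Or.inl (Nat.lt_succ_iff.mp h)
    · obtain ⟨u, hu, hd⟩ := G.exists_adj_of_dist_succ (le_antisymm hv h)
      exact Or.inr (Set.mem_biUnion hd hu)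

/-- The balls of radius `r` around the roots, as rooted induced subgraphs, are isomorphic. -/
def BallIso (G H : RootedGraph) (r : ℕ) : Prop :=
  ∃ e : G.graph.induce (G.ball r) ≃g H.graph.induce (H.ball r),
    e ⟨G.root, G.root_mem_ball r⟩ = ⟨H.root, H.root_mem_ball r⟩

theorem Iso.refl (G : RootedGraph) : Iso G G := ⟨SimpleGraph.Iso.refl, rfl⟩

theorem Iso.symm {G H : RootedGraph} : Iso G H → Iso H G := by
  rintro ⟨e, he⟩
  exact ⟨e.symm, by rw [← he]; exact e.symm_apply_apply _⟩

theorem Iso.trans {G H K : RootedGraph} : Iso G H → Iso H K → Iso G K := by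
  rintro ⟨e, he⟩ ⟨f, hf⟩
  exact ⟨e.trans f, by rw [← hf, ← he]; rfl⟩

theorem dist_iso {G H : RootedGraph} (e : G.graph ≃g H.graph) (he : e G.root = H.root)
    (v : G.V) : H.graph.dist H.root (e v) = G.graph.dist G.root v := by
  have key : ∀ {G H : RootedGraph} (e : G.graph ≃g H.graph) (_ : e G.root = H.root) (v : G.V),
      H.graph.dist H.root (e v) ≤ G.graph.dist G.root v := by
    intro G H e he v
    obtain ⟨p, hp⟩ := G.connected.exists_walk_length_eq_dist G.root v
    have h := SimpleGraph.dist_le (p.map e.toHom)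
    rw [SimpleGraph.Walk.length_map, hp] at h
    rw [← he]
    exact h
  refine le_antisymm (key e he v) ?_
  have h := key e.symm (by rw [← he]; exact e.symm_apply_apply _) (e v)
  rwa [show e.symm (e v) = v from e.symm_apply_apply v] at h

theorem mem_ball_iso {G H : RootedGraph} (e : G.graph ≃g H.graph) (he : e G.root = H.root)
    (r : ℕ) (v : G.V) : e v ∈ H.ball r ↔ v ∈ G.ball r := by
  simp [ball, dist_iso e he v]

theorem Iso.ballIso {G H : RootedGraph} (h : Iso G H) (r : ℕ) : BallIso G H r := by
  obtain ⟨e, he⟩ := h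
  refine ⟨⟨e.toEquiv.subtypeEquiv fun v => (mem_ball_iso e he r v).symm, ?_⟩, ?_⟩
  · intro a b
    exact e.map_rel_iff
  · exact Subtype.ext he

theorem BallIso.symm {G H : RootedGraph} {r : ℕ} : BallIso G H r → BallIso H G r := by
  rintro ⟨e, he⟩
  exact ⟨e.symm, by rw [← he]; exact e.symm_apply_apply _⟩

theorem BallIso.trans {G H K : RootedGraph} {r : ℕ} :
    BallIso G H r → BallIso H K r → BallIso G K r := by
  rintro ⟨e, he⟩ ⟨f, hf⟩
  exact ⟨e.trans f, by rw [← hf, ← he]; rfl⟩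

theorem dist_le_of_ballIso {G H : RootedGraph} {r : ℕ}
    (e : G.graph.induce (G.ball r) ≃g H.graph.induce (H.ball r))
    (he : e ⟨G.root, G.root_mem_ball r⟩ = ⟨H.root, H.root_mem_ball r⟩) (s : ℕ) (hs : s ≤ r) :
    ∀ v : G.ball r, G.graph.dist G.root v ≤ s → H.graph.dist H.root (e v) ≤ s := by
  induction s with
  | zero =>
    intro v hv
    have h0 : G.root = v := G.connected.dist_eq_zero_iff.mp (Nat.le_zero.mp hv)
    have h1 : v = ⟨G.root, G.root_mem_ball r⟩ := Subtype.ext h0.symm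
    rw [h1, he]
    simp
  | succ s ih =>
    intro v hv
    rcases Nat.lt_or_ge (G.graph.dist G.root v) (s + 1) with h | h
    · exact (ih (by omega) v (Nat.lt_succ_iff.mp h)).trans (Nat.le_succ s)
    · obtain ⟨u, hu, hd⟩ := G.exists_adj_of_dist_succ (le_antisymm hv h)
      have hur : u ∈ G.ball r := hd.trans (by omega)
      have h1 := ih (by omega) ⟨u, hur⟩ hd
      have h2 : (G.graph.induce (G.ball r)).Adj ⟨u, hur⟩ v := hu
      have h3 : H.graph.Adj (e ⟨u, hur⟩) (e v) := e.map_rel_iff.mpr h2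
      exact H.dist_le_succ_of_adj h3 h1

theorem BallIso.mono {G H : RootedGraph} {r s : ℕ} (h : BallIso G H r) (hs : s ≤ r) :
    BallIso G H s := by
  obtain ⟨e, he⟩ := h
  have he' : e.symm ⟨H.root, H.root_mem_ball r⟩ = ⟨G.root, G.root_mem_ball r⟩ := by
    rw [← he]; exact e.symm_apply_apply _
  have hG : ∀ v ∈ G.ball s, v ∈ G.ball r := fun v hv => le_trans hv hs
  have hH : ∀ v ∈ H.ball s, v ∈ H.ball r := fun v hv => le_trans hv hs
  refine ⟨⟨⟨fun v => ⟨(e ⟨v, hG v v.2⟩ : H.V), dist_le_of_ballIso e he s hs _ v.2⟩,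
    fun w => ⟨(e.symm ⟨w, hH w w.2⟩ : G.V), dist_le_of_ballIso e.symm he' s hs _ w.2⟩,
    fun v => ?_, fun w => ?_⟩, ?_⟩, ?_⟩
  · exact Subtype.ext (congrArg (Subtype.val : G.ball r → G.V)
      (e.symm_apply_apply ⟨v, hG v v.2⟩))
  · exact Subtype.ext (congrArg (Subtype.val : H.ball r → H.V)
      (e.apply_symm_apply ⟨w, hH w w.2⟩))
  · intro a b
    exact e.map_rel_iff (a := ⟨a, hG a a.2⟩) (b := ⟨b, hG b b.2⟩)
  · exact Subtype.ext (congrArg (Subtype.val : H.ball r → H.V) he)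

/-- `d_loc`: the infimum of `1 / (r + 1)` over the radii `r` at which the balls around the roots
are isomorphic. -/
noncomputable def dloc (G H : RootedGraph) : ℝ :=
  sInf {t : ℝ | ∃ r : ℕ, BallIso G H r ∧ t = 1 / ((r : ℝ) + 1)}

theorem dloc_le {G H : RootedGraph} {r : ℕ} (h : BallIso G H r) :
    dloc G H ≤ 1 / ((r : ℝ) + 1) :=
  csInf_le ⟨0, by rintro t ⟨r, -, rfl⟩; positivity⟩ ⟨r, h, rfl⟩

theorem dloc_congr {G G' H H' : RootedGraph} (hG : Iso G G') (hH : Iso H H') :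
    dloc G H = dloc G' H' := by
  have h : ∀ r, BallIso G H r ↔ BallIso G' H' r := fun r =>
    ⟨fun h => ((hG.ballIso r).symm.trans h).trans (hH.ballIso r),
      fun h => ((hG.ballIso r).trans h).trans (hH.ballIso r).symm⟩
  simp only [dloc, h]

/-- Balls of radius `0` are single vertices. -/
theorem ballIso_zero (G H : RootedGraph) : BallIso G H 0 := by
  have hs : ∀ (K : RootedGraph) (v : K.ball 0), v = ⟨K.root, K.root_mem_ball 0⟩ := fun K v =>
    Subtype.ext (K.connected.dist_eq_zero_iff.mp (Nat.le_zero.mp v.2)).symm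
  refine ⟨⟨⟨fun _ => ⟨H.root, H.root_mem_ball 0⟩, fun _ => ⟨G.root, G.root_mem_ball 0⟩,
    fun v => (hs G v).symm, fun v => (hs H v).symm⟩, ?_⟩, rfl⟩
  intro a b
  rw [hs G a, hs G b]
  simp

theorem dloc_set_nonempty (G H : RootedGraph) :
    {t : ℝ | ∃ r : ℕ, BallIso G H r ∧ t = 1 / ((r : ℝ) + 1)}.Nonempty :=
  ⟨_, 0, ballIso_zero G H, rfl⟩

theorem dloc_nonneg (G H : RootedGraph) : 0 ≤ dloc G H :=
  Real.sInf_nonneg (by rintro t ⟨r, -, rfl⟩; positivity)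

theorem dloc_self (G : RootedGraph) : dloc G G = 0 := by
  refine le_antisymm ?_ (dloc_nonneg G G)
  refine ge_of_tendsto' (tendsto_one_div_add_atTop_nhds_zero_nat (𝕜 := ℝ)) fun r => ?_
  exact dloc_le ((Iso.refl G).ballIso r)

theorem dloc_comm (G H : RootedGraph) : dloc G H = dloc H G := by
  have h : ∀ r, BallIso G H r ↔ BallIso H G r := fun r => ⟨BallIso.symm, BallIso.symm⟩
  simp only [dloc, h]

theorem dloc_triangle (G H K : RootedGraph) : dloc G K ≤ dloc G H + dloc H K := by
  rw [← sub_le_iff_le_add]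
  refine le_csInf (dloc_set_nonempty G H) ?_
  rintro _ ⟨r, hr, rfl⟩
  rw [sub_le_iff_le_add, ← sub_le_iff_le_add']
  refine le_csInf (dloc_set_nonempty H K) ?_
  rintro _ ⟨s, hs, rfl⟩
  rw [sub_le_iff_le_add']
  have hpr : (0 : ℝ) ≤ 1 / ((r : ℝ) + 1) := by positivity
  have hps : (0 : ℝ) ≤ 1 / ((s : ℝ) + 1) := by positivity
  rcases le_total r s with h | h
  · have := dloc_le (hr.trans (hs.mono h))
    linarith
  · have := dloc_le ((hr.mono h).trans hs)
    linarith

open Classical in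
/-- One step of the simple random walk: a uniformly chosen neighbour. (A vertex without
neighbours occurs only in the one-vertex graph; there the walk stays where it is.) -/
noncomputable def step (G : RootedGraph) (x : G.V) : PMF G.V :=
  if h : (G.nbrs x).Nonempty then PMF.uniformOfFinset (G.nbrs x) h else PMF.pure x

/-- The law of the position `X_n` at time `n` of the simple random walk started at the root. -/
noncomputable def walk (G : RootedGraph) : ℕ → PMF G.V
  | 0 => PMF.pure G.root
  | n + 1 => (walk G n).bind G.step

theorem mem_nbrs_iso {G H : RootedGraph} (e : G.graph ≃g H.graph) (x y : G.V) :
    e y ∈ H.nbrs (e x) ↔ y ∈ G.nbrs x := by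
  rw [mem_nbrs, mem_nbrs]
  exact e.map_rel_iff

theorem nbrs_iso {G H : RootedGraph} (e : G.graph ≃g H.graph) (x : G.V) :
    H.nbrs (e x) = (G.nbrs x).map e.toEquiv.toEmbedding := by
  ext w
  obtain ⟨y, rfl⟩ := e.surjective w
  rw [mem_nbrs_iso]
  exact (Finset.mem_map' (f := e.toEquiv.toEmbedding)).symm

theorem map_apply_iso {G H : RootedGraph} (e : G.graph ≃g H.graph) (p : PMF G.V) (y : G.V) :
    p.map e (e y) = p y := by
  classical
  rw [PMF.map_apply, tsum_eq_single y]
  · simp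
  · intro z hz
    have : e y ≠ e z := fun h => hz (e.injective h.symm)
    simp [this]

theorem step_iso {G H : RootedGraph} (e : G.graph ≃g H.graph) (x : G.V) :
    H.step (e x) = (G.step x).map e := by
  classical
  ext w
  obtain ⟨y, rfl⟩ := e.surjective w
  rw [map_apply_iso]
  have hn : (H.nbrs (e x)).Nonempty ↔ (G.nbrs x).Nonempty := by
    rw [nbrs_iso e x, Finset.map_nonempty]
  by_cases h : (G.nbrs x).Nonempty
  · have hc : (H.nbrs (e x)).card = (G.nbrs x).card := by
      rw [nbrs_iso e x, Finset.card_map]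
    rw [step, step, dif_pos h, dif_pos (hn.mpr h), PMF.uniformOfFinset_apply,
      PMF.uniformOfFinset_apply, hc]
    simp only [mem_nbrs_iso]
  · rw [step, step, dif_neg h, dif_neg (fun h' => h (hn.mp h'))]
    simp [PMF.pure_apply]

theorem walk_iso {G H : RootedGraph} (e : G.graph ≃g H.graph) (he : e G.root = H.root) (n : ℕ) :
    H.walk n = (G.walk n).map e := by
  induction n with
  | zero => simp [walk, PMF.pure_map, he]
  | succ n ih =>
    rw [walk, walk, ih, PMF.bind_map, PMF.map_bind]
    congr 1
    funext x
    exact step_iso e x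

/-- `f` is harmonic: its value at every vertex is the average of its values at the neighbours. -/
def IsHarmonic (G : RootedGraph) (f : G.V → ℝ) : Prop :=
  ∀ v, f v = (∑ u ∈ G.nbrs v, f u) / ((G.nbrs v).card : ℝ)

/-- `G` is Liouville: every bounded harmonic function is constant. -/
def IsLiouville (G : RootedGraph) : Prop :=
  ∀ f : G.V → ℝ, G.IsHarmonic f → (∃ M : ℝ, ∀ v, |f v| ≤ M) → ∃ c : ℝ, ∀ v, f v = c

theorem IsLiouville.of_iso {G H : RootedGraph} (h : Iso G H) (hG : G.IsLiouville) :
    H.IsLiouville := by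
  obtain ⟨e, -⟩ := h
  rintro f hf ⟨M, hM⟩
  obtain ⟨c, hc⟩ := hG (fun v => f (e v)) (fun v => by
    have h1 := hf (e v)
    rw [nbrs_iso e v, Finset.sum_map, Finset.card_map] at h1
    exact h1) ⟨M, fun v => hM (e v)⟩
  refine ⟨c, fun w => ?_⟩
  obtain ⟨y, rfl⟩ := e.surjective w
  exact hc y

instance setoid : Setoid RootedGraph where
  r := Iso
  iseqv := ⟨Iso.refl, Iso.symm, Iso.trans⟩

end RootedGraph

/-- `𝒢_•`: the isomorphism classes of rooted graphs. -/
def RootedGraphClass : Type 1 := Quotient RootedGraph.setoid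

namespace RootedGraphClass

/-- The isomorphism class of a rooted graph. -/
def mk (G : RootedGraph) : RootedGraphClass := Quotient.mk RootedGraph.setoid G

/-- The topology of `𝒢_•` is the one given by the distance `d_loc`. -/
noncomputable instance : PseudoMetricSpace RootedGraphClass where
  dist := Quotient.lift₂ RootedGraph.dloc fun _ _ _ _ hG hH => RootedGraph.dloc_congr hG hH
  dist_self := by rintro ⟨G⟩; exact RootedGraph.dloc_self G
  dist_comm := by rintro ⟨G⟩ ⟨H⟩; exact RootedGraph.dloc_comm G H
  dist_triangle := by rintro ⟨G⟩ ⟨H⟩ ⟨K⟩; exact RootedGraph.dloc_triangle G H K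

noncomputable instance : MeasurableSpace RootedGraphClass := borel RootedGraphClass

instance : BorelSpace RootedGraphClass := ⟨rfl⟩

/-- `#B_G(ρ, n)`: the number of vertices within distance `n` from the root. -/
noncomputable def ballCard (n : ℕ) : RootedGraphClass → ℕ :=
  Quotient.lift (fun G => (G.ball n).ncard) (by
    intro G H h
    obtain ⟨e, -⟩ := RootedGraph.Iso.ballIso h n
    exact Nat.card_congr e.toEquiv)

/-- For a fixed class `(G, ρ)`, the law of `(G, X_n)` in `𝒢_•`, where `X` is the simple random
walk on `G` started at `ρ`. -/
noncomputable def rerootLaw (n : ℕ) : RootedGraphClass → PMF RootedGraphClass :=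
  Quotient.lift (fun G => (G.walk n).map fun x => mk (G.reroot x)) (by
    rintro G H ⟨e, he⟩
    rw [RootedGraph.walk_iso e he n, PMF.map_comp]
    congr 1
    funext x
    exact Quotient.sound ⟨e, rfl⟩)

/-- The Liouville property of (the underlying graph of) a class. -/
def IsLiouville : RootedGraphClass → Prop :=
  Quotient.lift RootedGraph.IsLiouville fun _ _ h =>
    propext ⟨RootedGraph.IsLiouville.of_iso h, RootedGraph.IsLiouville.of_iso h.symm⟩

end RootedGraphClass

/-- The random rooted graph `X = (G, ρ)` is stationary: for every `n ≥ 1`, `(G, X_n)` has the same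
law as `(G, ρ)`, where, conditionally on `(G, ρ)`, `X_n` is the position at time `n` of the simple
random walk on `G` started at `ρ`. -/
def IsStationaryRandomGraph {Ω : Type*} [MeasurableSpace Ω] (μ : Measure Ω)
    (X : Ω → RootedGraphClass) : Prop :=
  ∀ n : ℕ, 1 ≤ n → ∀ A : Set RootedGraphClass, MeasurableSet A →
    ∫⁻ ω, (RootedGraphClass.rerootLaw n (X ω)).toMeasure A ∂μ = μ (X ⁻¹' A)

/-- `E[log #B_G(ρ, n)]`, as an element of `[0, ∞]`. -/
noncomputable def meanLogBall {Ω : Type*} [MeasurableSpace Ω] (μ : Measure Ω)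
    (X : Ω → RootedGraphClass) (n : ℕ) : ℝ≥0∞ :=
  ∫⁻ ω, ENNReal.ofReal (Real.log (RootedGraphClass.ballCard n (X ω))) ∂μ

/-!
The proof is the entropy argument of Kaimanovich and Vershik, in a form that needs neither tail
σ-algebras nor an ergodic theorem.

Write `H(Z)` for Shannon entropy, `p_n(x, ·)` for the law of the walk at time `n` started at `x`,
and `w` for the law of the first step from the root `ρ`. By the Markov property at time `1`,
`p_{n+1}(ρ, ·)` is the `w`-mixture of the laws `p_n(x, ·)`, and the entropy gained by mixing,
`J_n = H(p_{n+1}(ρ, ·)) - ∑ x, w x * H(p_n(x, ·))` (the mutual information of `X_1` and `X_{n+1}`),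
is nonnegative. Stationarity turns the second term into the mean of `H(p_n(ρ, ·))`, so the
expectations of `J_0, …, J_{N-1}` telescope to `E H(p_N(ρ, ·)) ≤ E log #B(ρ, N)`
(`IsStationaryRandomGraph.sum_lintegral_entropyGain_le`, `PMF.entropy_le_log_card`).
Subexponential growth makes this `o(N)`, hence `inf_n J_n = 0` almost surely
(`IsStationaryRandomGraph.ae_iInf_entropyGain_eq_zero`).

On the other hand relative entropy dominates the squared Hellinger distance
(`Real.sum_mul_sq_sqrt_sub_sqrt_le`), which by Cauchy-Schwarz controls the difference of the means
of a bounded function. A harmonic function `f` has mean `f x` under `p_n(x, ·)` and mean `f ρ` under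
`p_{n+1}(ρ, ·)`, so `∑ x, w x * (f x - f ρ) ^ 2 ≤ 4 * (sup |f|) ^ 2 * J_n` for every `n`
(`RootedGraph.sum_step_mul_sq_le_entropyGain`). Therefore almost surely all bounded harmonic
functions agree at the root and at its neighbours. By stationarity the same then holds almost surely
at all vertices that the walk can reach, that is at all vertices, and the graph is Liouville.

The measurability facts come from locality: a quantity that depends only on the ball of some
radius about the root is locally constant for `d_loc`. Entropies are of this kind, and the
re-rooting kernel applied to an open set is an increasing limit of such quantities
(`RootedGraphClass.measurable_toMeasure_rerootLaw`).
-/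

/-! ### Entropy of discrete distributions -/

namespace PMF

variable {α β : Type*}

/-- The Shannon entropy of a discrete distribution, in nats. The series is only used for
distributions of finite support; its junk value `0` when not summable plays no role. -/
noncomputable def entropy (p : PMF α) : ℝ :=
  ∑' x, Real.negMulLog (p x).toReal

/-- The mean of a real function under a discrete distribution, used for finite support only. -/
noncomputable def mean (p : PMF α) (f : α → ℝ) : ℝ :=
  ∑' x, (p x).toReal * f x

theorem map_apply_of_injective {f : α → β} (hf : Function.Injective f) (p : PMF α) (x : α) :
    p.map f (f x) = p x := by
  classical
  rw [PMF.map_apply, tsum_eq_single x]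
  · simp
  · intro z hz
    simp [hf.ne hz.symm]

theorem entropy_map_of_injective {f : α → β} (hf : Function.Injective f) (p : PMF α) :
    (p.map f).entropy = p.entropy := by
  unfold entropy
  rw [← hf.tsum_eq (f := fun y => Real.negMulLog (p.map f y).toReal)]
  · simp [map_apply_of_injective hf]
  · intro y hy
    by_contra h
    refine hy ?_
    have : p.map f y = 0 := by
      rw [PMF.apply_eq_zero_iff, PMF.mem_support_map_iff]
      rintro ⟨a, -, rfl⟩
      exact h ⟨a, rfl⟩
    simp [this]

theorem entropy_eq_sum {p : PMF α} {T : Finset α} (hT : p.support ⊆ T) :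
    p.entropy = ∑ x ∈ T, Real.negMulLog (p x).toReal := by
  refine tsum_eq_sum fun x hx => ?_
  have : p x = 0 := (p.apply_eq_zero_iff x).2 fun h => hx (hT h)
  simp [this]

theorem mean_eq_sum {p : PMF α} {T : Finset α} (hT : p.support ⊆ T) (f : α → ℝ) :
    p.mean f = ∑ x ∈ T, (p x).toReal * f x := by
  refine tsum_eq_sum fun x hx => ?_
  have : p x = 0 := (p.apply_eq_zero_iff x).2 fun h => hx (hT h)
  simp [this]

theorem toReal_le_one (p : PMF α) (x : α) : (p x).toReal ≤ 1 :=
  ENNReal.toReal_le_of_le_ofReal zero_le_one (by simpa using p.coe_le_one x)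

theorem sum_toReal_eq_one {p : PMF α} {T : Finset α} (hT : p.support ⊆ T) :
    ∑ x ∈ T, (p x).toReal = 1 := by
  have h : ∑' x, p x = ∑ x ∈ T, p x :=
    tsum_eq_sum fun x hx => (p.apply_eq_zero_iff x).2 fun h => hx (hT h)
  rw [← ENNReal.toReal_sum fun x _ => p.apply_ne_top x, ← h, p.tsum_coe, ENNReal.toReal_one]

theorem bind_apply_toReal {w : PMF α} {S : Finset α} (hS : w.support ⊆ S) (κ : α → PMF β)
    (y : β) : (w.bind κ y).toReal = ∑ x ∈ S, (w x).toReal * (κ x y).toReal := by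
  rw [PMF.bind_apply, tsum_eq_sum (s := S), ENNReal.toReal_sum]
  · simp
  · exact fun x _ => ENNReal.mul_ne_top (w.apply_ne_top x) ((κ x).apply_ne_top y)
  · intro x hx
    rw [(w.apply_eq_zero_iff x).2 fun h => hx (hS h), zero_mul]

theorem entropy_nonneg (p : PMF α) : 0 ≤ p.entropy :=
  tsum_nonneg fun x => Real.negMulLog_nonneg ENNReal.toReal_nonneg (p.toReal_le_one x)

/-- Jensen's inequality for `-t log t` with uniform weights on `T`. -/
theorem entropy_le_log_card {p : PMF α} {T : Finset α} (hT : p.support ⊆ T) :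
    p.entropy ≤ Real.log T.card := by
  have hne : T.Nonempty := by
    obtain ⟨x, hx⟩ := p.support_nonempty
    exact ⟨x, hT hx⟩
  have hpos : (0 : ℝ) < T.card := by exact_mod_cast hne.card_pos
  have h := Real.concaveOn_negMulLog.le_map_sum (t := T) (w := fun _ => (T.card : ℝ)⁻¹)
    (p := fun x => (p x).toReal) (fun _ _ => by positivity)
    (by rw [Finset.sum_const, nsmul_eq_mul, mul_inv_cancel₀ hpos.ne'])
    (fun _ _ => ENNReal.toReal_nonneg)
  simp only [smul_eq_mul, ← Finset.mul_sum, sum_toReal_eq_one hT, ← entropy_eq_sum hT,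
    mul_one] at h
  rw [Real.negMulLog, Real.log_inv, neg_mul_neg] at h
  exact le_of_mul_le_mul_left h (inv_pos.2 hpos)

end PMF

namespace Real

/-- The pointwise comparison of relative entropy with the squared Hellinger distance; it is
`log u ≤ u - 1` at `u = √(b / a)`. -/
theorem sq_sqrt_sub_sqrt_le {a b : ℝ} (ha : 0 ≤ a) (hb : 0 < b) :
    (√a - √b) ^ 2 ≤ a * log a - a * log b - a + b := by
  obtain ⟨t, ht, rfl⟩ : ∃ t : ℝ, 0 < t ∧ b = t ^ 2 := ⟨√b, sqrt_pos.2 hb, (sq_sqrt hb.le).symm⟩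
  rcases ha.eq_or_lt with rfl | ha
  · simp [sqrt_sq ht.le]
  obtain ⟨s, hs, rfl⟩ : ∃ s : ℝ, 0 < s ∧ a = s ^ 2 := ⟨√a, sqrt_pos.2 ha, (sq_sqrt ha.le).symm⟩
  rw [sqrt_sq ht.le, sqrt_sq hs.le, log_pow, log_pow]
  -- After `a = s ^ 2` and `b = t ^ 2` this is the inequality `log (t / s) ≤ t / s - 1`.
  have h1 := log_le_sub_one_of_pos (div_pos ht hs)
  rw [log_div ht.ne' hs.ne'] at h1
  have h2 := mul_le_mul_of_nonneg_left h1 (sq_nonneg s)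
  have h3 : s ^ 2 * (t / s - 1) = s * t - s ^ 2 := by field_simp
  push_cast
  nlinarith

/-- Jensen's inequality for `-t log t` with an explicit remainder. -/
theorem sum_mul_sq_sqrt_sub_sqrt_le {ι : Type*} {S : Finset ι} {w a : ι → ℝ}
    (hw : ∀ x ∈ S, 0 ≤ w x) (hw1 : ∑ x ∈ S, w x = 1) (ha : ∀ x ∈ S, 0 ≤ a x) :
    ∑ x ∈ S, w x * (√(a x) - √(∑ z ∈ S, w z * a z)) ^ 2 ≤
      negMulLog (∑ z ∈ S, w z * a z) - ∑ x ∈ S, w x * negMulLog (a x) := by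
  set b := ∑ z ∈ S, w z * a z with hb
  have hwa : ∀ x ∈ S, 0 ≤ w x * a x := fun x hx => mul_nonneg (hw x hx) (ha x hx)
  have key : negMulLog b - ∑ x ∈ S, w x * negMulLog (a x) =
      ∑ x ∈ S, w x * (a x * log (a x) - a x * log b - a x + b) := by
    have h1 : ∀ x ∈ S, w x * (a x * log (a x) - a x * log b - a x + b) =
        - (w x * negMulLog (a x)) - (w x * a x) * log b - w x * a x + w x * b := by
      intro x _
      simp only [negMulLog]
      ring
    rw [Finset.sum_congr rfl h1, Finset.sum_add_distrib, Finset.sum_sub_distrib,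
      Finset.sum_sub_distrib, Finset.sum_neg_distrib, ← Finset.sum_mul, ← Finset.sum_mul, ← hb,
      hw1, negMulLog]
    ring
  rw [key]
  refine Finset.sum_le_sum fun x hx => ?_
  -- If the average `b` vanishes, so does every `w x * a x`, and both sides are zero termwise.
  rcases (Finset.sum_nonneg hwa).eq_or_lt with h0 | h0
  · have h2 : w x * a x = 0 := (Finset.sum_eq_zero_iff_of_nonneg hwa).1 h0.symm x hx
    rw [← hb] at h0
    rw [← h0]
    rcases mul_eq_zero.1 h2 with h3 | h3 <;> simp [h3]
  · exact mul_le_mul_of_nonneg_left (sq_sqrt_sub_sqrt_le (ha x hx) h0) (hw x hx)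

end Real

namespace PMF
variable {α β : Type*}

/-- Means of a bounded function under two distributions that are close in Hellinger distance are
close. The constant comes from `(√a + √b) ^ 2 ≤ 2 * (a + b)`, whose right side sums to `4`. -/
theorem sq_mean_sub_mean_le {p q : PMF β} {T : Finset β} (hp : p.support ⊆ T) (hq : q.support ⊆ T)
    {f : β → ℝ} {M : ℝ} (hf : ∀ y, |f y| ≤ M) :
    (p.mean f - q.mean f) ^ 2 ≤
      4 * M ^ 2 * ∑ y ∈ T, (√(p y).toReal - √(q y).toReal) ^ 2 := by
  have hpp : ∀ y, √(p y).toReal ^ 2 = (p y).toReal := fun y => Real.sq_sqrt ENNReal.toReal_nonneg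
  have hqq : ∀ y, √(q y).toReal ^ 2 = (q y).toReal := fun y => Real.sq_sqrt ENNReal.toReal_nonneg
  have h1 : p.mean f - q.mean f = ∑ y ∈ T, (√(p y).toReal - √(q y).toReal) *
      ((√(p y).toReal + √(q y).toReal) * f y) := by
    rw [mean_eq_sum hp, mean_eq_sum hq, ← Finset.sum_sub_distrib]
    refine Finset.sum_congr rfl fun y _ => ?_
    linear_combination (-f y) * hpp y + f y * hqq y
  have h2 : ∑ y ∈ T, ((√(p y).toReal + √(q y).toReal) * f y) ^ 2 ≤ 4 * M ^ 2 := by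
    have h3 : ∀ y ∈ T, ((√(p y).toReal + √(q y).toReal) * f y) ^ 2 ≤
        2 * M ^ 2 * ((p y).toReal + (q y).toReal) := by
      intro y _
      have h4 : f y ^ 2 ≤ M ^ 2 := sq_le_sq.2 ((hf y).trans (le_abs_self M))
      have h5 : (√(p y).toReal + √(q y).toReal) ^ 2 ≤ 2 * ((p y).toReal + (q y).toReal) := by
        nlinarith [sq_nonneg (√(p y).toReal - √(q y).toReal), hpp y, hqq y]
      rw [mul_pow]
      calc _ ≤ 2 * ((p y).toReal + (q y).toReal) * M ^ 2 := by gcongr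
        _ = _ := by ring
    refine (Finset.sum_le_sum h3).trans_eq ?_
    rw [← Finset.mul_sum, Finset.sum_add_distrib, sum_toReal_eq_one hp, sum_toReal_eq_one hq]
    ring
  rw [h1, mul_comm]
  refine (Finset.sum_mul_sq_le_sq_mul_sq _ _ _).trans ?_
  gcongr

theorem mean_bind {w : PMF α} {κ : α → PMF β} {S : Finset α} (hS : w.support ⊆ S)
    {T : Finset β} (hT : ∀ x ∈ S, (κ x).support ⊆ T) (f : β → ℝ) :
    (w.bind κ).mean f = w.mean fun x => (κ x).mean f := by
  have hb : (w.bind κ).support ⊆ T := by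
    intro y hy
    obtain ⟨x, hx, hy⟩ := (PMF.mem_support_bind_iff w κ y).1 hy
    exact hT x (hS hx) hy
  rw [mean_eq_sum hb, mean_eq_sum hS]
  simp only [bind_apply_toReal hS, Finset.sum_mul]
  rw [Finset.sum_comm]
  refine Finset.sum_congr rfl fun x hx => ?_
  rw [mean_eq_sum (hT x hx), Finset.mul_sum]
  simp only [mul_assoc]

/-- The entropy gained by mixing the distributions `κ x` with weights `w` controls how far the
means of a bounded function under the `κ x` are from its mean under the mixture. -/
theorem sum_mul_sq_le_entropy_bind_sub {w : PMF α} {κ : α → PMF β} {S : Finset α}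
    (hS : w.support ⊆ S) {T : Finset β} (hT : ∀ x ∈ S, (κ x).support ⊆ T) {f : β → ℝ} {M : ℝ}
    (hf : ∀ y, |f y| ≤ M) :
    ∑ x ∈ S, (w x).toReal * ((κ x).mean f - (w.bind κ).mean f) ^ 2 ≤
      4 * M ^ 2 * ((w.bind κ).entropy - ∑ x ∈ S, (w x).toReal * (κ x).entropy) := by
  have hb : (w.bind κ).support ⊆ T := by
    intro y hy
    obtain ⟨x, hx, hy⟩ := (PMF.mem_support_bind_iff w κ y).1 hy
    exact hT x (hS hx) hy
  have hJ : ∑ y ∈ T, ∑ x ∈ S, (w x).toReal * (√(κ x y).toReal - √(w.bind κ y).toReal) ^ 2 ≤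
      (w.bind κ).entropy - ∑ x ∈ S, (w x).toReal * (κ x).entropy := by
    have h1 : ∑ x ∈ S, (w x).toReal * (κ x).entropy =
        ∑ y ∈ T, ∑ x ∈ S, (w x).toReal * Real.negMulLog (κ x y).toReal := by
      rw [Finset.sum_comm]
      refine Finset.sum_congr rfl fun x hx => ?_
      rw [entropy_eq_sum (hT x hx), Finset.mul_sum]
    rw [h1, entropy_eq_sum hb, ← Finset.sum_sub_distrib]
    refine Finset.sum_le_sum fun y _ => ?_
    rw [bind_apply_toReal hS]
    exact Real.sum_mul_sq_sqrt_sub_sqrt_le (fun _ _ => ENNReal.toReal_nonneg)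
      (sum_toReal_eq_one hS) (fun _ _ => ENNReal.toReal_nonneg)
  refine le_trans ?_ (mul_le_mul_of_nonneg_left hJ (by positivity))
  rw [Finset.sum_comm, Finset.mul_sum]
  refine Finset.sum_le_sum fun x hx => ?_
  rw [← Finset.mul_sum, mul_left_comm]
  exact mul_le_mul_of_nonneg_left (sq_mean_sub_mean_le (hT x hx) hb hf) ENNReal.toReal_nonneg

end PMF

/-! ### Balls as rooted graphs, and locality of the walk -/

namespace RootedGraph

/-- A geodesic from `x` of length at most `s` cannot leave the ball of radius `R` about the root
when `x` is at distance at most `R - s` from the root. -/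
theorem exists_walk_induce_ball (G : RootedGraph) {R : ℕ} (x : G.ball R) (s : ℕ)
    (hs : G.graph.dist G.root x + s ≤ R) (y : G.V) (hy : G.graph.dist x y ≤ s) :
    ∃ (h : y ∈ G.ball R) (p : (G.graph.induce (G.ball R)).Walk x ⟨y, h⟩), p.length ≤ s := by
  induction s generalizing y with
  | zero =>
    obtain rfl : (x : G.V) = y := G.connected.dist_eq_zero_iff.1 (Nat.le_zero.1 hy)
    exact ⟨x.2, SimpleGraph.Walk.nil, le_rfl⟩
  | succ s ih =>
    rcases Nat.lt_or_ge (G.graph.dist x y) (s + 1) with h | h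
    · obtain ⟨hy, p, hp⟩ := ih (by omega) y (Nat.lt_succ_iff.1 h)
      exact ⟨hy, p, hp.trans s.le_succ⟩
    · obtain ⟨u, hu, hd⟩ := (G.reroot x).exists_adj_of_dist_succ (le_antisymm hy h)
      obtain ⟨hu', p, hp⟩ := ih (by omega) u hd
      have hyR : y ∈ G.ball R :=
        (G.connected.dist_triangle (u := G.root) (v := x) (w := y)).trans (by omega)
      have ha : (G.graph.induce (G.ball R)).Adj ⟨u, hu'⟩ ⟨y, hyR⟩ := hu
      refine ⟨hyR, p.concat ha, ?_⟩
      rw [SimpleGraph.Walk.length_concat]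
      omega

/-- The ball of radius `R` about the root, as a rooted graph of its own. -/
def ballGraph (G : RootedGraph) (R : ℕ) : RootedGraph where
  V := G.ball R
  graph := G.graph.induce (G.ball R)
  root := ⟨G.root, G.root_mem_ball R⟩
  countable := have := G.countable; inferInstance
  connected := by
    have h : ∀ y : G.ball R, (G.graph.induce (G.ball R)).Reachable
        ⟨G.root, G.root_mem_ball R⟩ y := fun y => by
      obtain ⟨_, p, -⟩ := G.exists_walk_induce_ball ⟨G.root, G.root_mem_ball R⟩ R (by simp) y y.2
      exact ⟨p⟩
    exact { preconnected := fun a b => (h a).symm.trans (h b)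
            nonempty := ⟨⟨G.root, G.root_mem_ball R⟩⟩ }
  locallyFinite := fun _ => have := (G.ball_finite R).to_subtype; Set.toFinite _

/-- The inclusion of the ball of radius `R` into the whole graph. -/
def ballIncl (G : RootedGraph) (R : ℕ) : (G.ballGraph R).V → G.V :=
  Subtype.val

theorem ballIncl_injective (G : RootedGraph) (R : ℕ) : Function.Injective (G.ballIncl R) :=
  Subtype.val_injective

theorem range_ballIncl (G : RootedGraph) (R : ℕ) : Set.range (G.ballIncl R) = G.ball R :=
  Subtype.range_val

theorem adj_ballIncl {G : RootedGraph} {R : ℕ} {x y : (G.ballGraph R).V} :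
    G.graph.Adj (G.ballIncl R x) (G.ballIncl R y) ↔ (G.ballGraph R).graph.Adj x y :=
  Iff.rfl

/-- Around a vertex `x` well inside the ball of radius `R`, passing to that ball does not change
the ball of radius `r` about `x`. -/
theorem ballIso_reroot_ballGraph (G : RootedGraph) {R r : ℕ} (x : (G.ballGraph R).V)
    (h : G.graph.dist G.root (G.ballIncl R x) + r ≤ R) :
    BallIso ((G.ballGraph R).reroot x) (G.reroot (G.ballIncl R x)) r := by
  have h1 : ∀ v : (G.ballGraph R).V, v ∈ ((G.ballGraph R).reroot x).ball r →
      G.ballIncl R v ∈ (G.reroot (G.ballIncl R x)).ball r := by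
    intro v hv
    obtain ⟨p, hp⟩ := (G.ballGraph R).connected.exists_walk_length_eq_dist x v
    let i : (G.ballGraph R).graph →g G.graph := ⟨G.ballIncl R, adj_ballIncl.2⟩
    have h2 := SimpleGraph.dist_le (p.map i)
    rw [SimpleGraph.Walk.length_map, hp] at h2
    exact h2.trans hv
  have h2 : ∀ v : G.V, v ∈ (G.reroot (G.ballIncl R x)).ball r → ∃ h : v ∈ G.ball R,
      (⟨v, h⟩ : G.ball R) ∈ ((G.ballGraph R).reroot x).ball r := by
    intro v hv
    obtain ⟨hvR, p, hp⟩ := G.exists_walk_induce_ball x r h v hv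
    exact ⟨hvR, (SimpleGraph.dist_le p).trans hp⟩
  exact ⟨⟨⟨fun v => ⟨v.1.1, h1 v.1 v.2⟩, fun w => ⟨⟨w.1, (h2 w.1 w.2).1⟩, (h2 w.1 w.2).2⟩,
    fun _ => rfl, fun _ => rfl⟩, Iff.rfl⟩, rfl⟩

theorem map_step_ballGraph (G : RootedGraph) {R : ℕ} (x : (G.ballGraph R).V)
    (hx : G.graph.dist G.root (G.ballIncl R x) < R) :
    ((G.ballGraph R).step x).map (G.ballIncl R) = G.step (G.ballIncl R x) := by
  classical
  have hmem : ∀ z, z ∈ (G.ballGraph R).nbrs x ↔ G.ballIncl R z ∈ G.nbrs (G.ballIncl R x) :=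
    fun z => by rw [mem_nbrs, mem_nbrs, adj_ballIncl]
  have hn : G.nbrs (G.ballIncl R x) =
      ((G.ballGraph R).nbrs x).map ⟨G.ballIncl R, G.ballIncl_injective R⟩ := by
    ext y
    rw [Finset.mem_map]
    constructor
    · intro hy
      have hyR : y ∈ G.ball R :=
        (G.dist_le_succ_of_adj (mem_nbrs.1 hy) le_rfl).trans (Nat.succ_le_of_lt hx)
      obtain ⟨z, rfl⟩ := (G.range_ballIncl R).ge hyR
      exact ⟨z, (hmem z).2 hy, rfl⟩
    · rintro ⟨z, hz, rfl⟩
      exact (hmem z).1 hz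
  have hne : (G.nbrs (G.ballIncl R x)).Nonempty ↔ ((G.ballGraph R).nbrs x).Nonempty := by
    rw [hn, Finset.map_nonempty]
  have hc : (G.nbrs (G.ballIncl R x)).card = ((G.ballGraph R).nbrs x).card := by
    rw [hn, Finset.card_map]
  ext y
  by_cases hy : y ∈ Set.range (G.ballIncl R)
  · obtain ⟨z, rfl⟩ := hy
    rw [PMF.map_apply_of_injective (G.ballIncl_injective R)]
    by_cases h : (G.nbrs (G.ballIncl R x)).Nonempty
    · rw [step, step, dif_pos h, dif_pos (hne.1 h), PMF.uniformOfFinset_apply,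
        PMF.uniformOfFinset_apply, hc]
      simp only [hmem]
    · rw [step, step, dif_neg h, dif_neg fun h' => h (hne.2 h')]
      simp only [PMF.pure_apply, (G.ballIncl_injective R).eq_iff]
  · have h0 : ((G.ballGraph R).step x).map (G.ballIncl R) y = 0 := by
      rw [PMF.apply_eq_zero_iff, PMF.mem_support_map_iff]
      rintro ⟨z, -, rfl⟩
      exact hy ⟨z, rfl⟩
    have hyn : y ∉ G.nbrs (G.ballIncl R x) := fun h => by
      rw [hn, Finset.mem_map] at h
      obtain ⟨z, -, rfl⟩ := h
      exact hy ⟨z, rfl⟩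
    have hyx : y ≠ G.ballIncl R x := fun h => hy (h ▸ ⟨x, rfl⟩)
    rw [h0, step]
    split_ifs with h
    · rw [PMF.uniformOfFinset_apply, if_neg hyn]
    · rw [PMF.pure_apply, if_neg hyx]

theorem mem_support_step {G : RootedGraph} {x y : G.V} :
    y ∈ (G.step x).support ↔ G.graph.Adj x y ∨ (¬ (G.nbrs x).Nonempty ∧ y = x) := by
  rw [step]
  split_ifs with h
  · simp [mem_nbrs, h]
  · have : ¬ G.graph.Adj x y := fun ha => h ⟨y, mem_nbrs.2 ha⟩
    simp [PMF.support_pure, this, h]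

theorem support_walk_subset_ball (G : RootedGraph) (n : ℕ) : (G.walk n).support ⊆ G.ball n := by
  induction n with
  | zero =>
    intro y hy
    rw [walk, PMF.support_pure] at hy
    rw [Set.mem_singleton_iff.1 hy]
    exact G.root_mem_ball 0
  | succ n ih =>
    intro y hy
    obtain ⟨x, hx, hy⟩ := (PMF.mem_support_bind_iff _ _ y).1 hy
    rcases mem_support_step.1 hy with h | ⟨-, rfl⟩
    · exact G.dist_le_succ_of_adj h (ih hx)
    · exact (ih hx).trans n.le_succ

/-- Up to time `R` the walk does not notice whether it runs in the whole graph or in the ball of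
radius `R`: it steps from vertices at distance less than `R` only. -/
theorem map_walk_ballGraph (G : RootedGraph) {n R : ℕ} (hn : n ≤ R) :
    ((G.ballGraph R).walk n).map (G.ballIncl R) = G.walk n := by
  induction n with
  | zero => exact PMF.pure_map _ _
  | succ n ih =>
    have ih := ih (by omega)
    rw [walk, walk, ← ih, PMF.map_bind, PMF.bind_map]
    ext y
    rw [PMF.bind_apply, PMF.bind_apply]
    refine tsum_congr fun x => ?_
    -- Only vertices in the support matter, and these are at distance at most `n < R`.
    by_cases hx : (G.ballGraph R).walk n x = 0
    · simp [hx]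
    · have h1 : G.ballIncl R x ∈ (G.walk n).support := by
        rw [← ih, PMF.mem_support_map_iff]
        exact ⟨x, (PMF.mem_support_iff _ _).2 hx, rfl⟩
      rw [map_step_ballGraph G x (lt_of_le_of_lt (G.support_walk_subset_ball n h1) hn)]
      rfl

theorem entropy_walk_eq_of_ballIso {G H : RootedGraph} {n : ℕ} (h : BallIso G H n) :
    (G.walk n).entropy = (H.walk n).entropy := by
  obtain ⟨e, he⟩ := h
  rw [← G.map_walk_ballGraph le_rfl, ← H.map_walk_ballGraph le_rfl,
    PMF.entropy_map_of_injective (G.ballIncl_injective n),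
    PMF.entropy_map_of_injective (H.ballIncl_injective n),
    walk_iso (G := G.ballGraph n) (H := H.ballGraph n) e he]
  exact (PMF.entropy_map_of_injective (α := (G.ballGraph n).V) e.injective _).symm

/-- The law at time `n` of the walk started at an arbitrary vertex `x`. It is a distribution on
`G.V` rather than on the definitionally equal vertex type of `G.reroot x`. -/
noncomputable def walkFrom (G : RootedGraph) (x : G.V) (n : ℕ) : PMF G.V :=
  (G.reroot x).walk n

/-- The Markov property at time `1`; `walk` itself is defined by the Markov property at the last
step. -/
theorem walk_succ_eq_bind_walkFrom (G : RootedGraph) (n : ℕ) :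
    G.walk (n + 1) = (G.step G.root).bind fun x => G.walkFrom x n := by
  induction n with
  | zero =>
    rw [walk, walk, PMF.pure_bind]
    exact (PMF.bind_pure _).symm
  | succ n ih =>
    rw [walk, ih, PMF.bind_bind]
    rfl

theorem exists_walk_apply_ne_zero (G : RootedGraph) (x : G.V) : ∃ n, G.walk n x ≠ 0 := by
  have h : ∀ n x, G.graph.dist G.root x = n → G.walk n x ≠ 0 := by
    intro n
    induction n with
    | zero =>
      intro x hx
      have := G.connected.dist_eq_zero_iff.1 hx
      simp [walk, this]
    | succ n ih =>
      intro x hx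
      obtain ⟨u, hu, hd⟩ := G.exists_adj_of_dist_succ hx
      have hdu : G.graph.dist G.root u = n := by
        have := G.dist_le_succ_of_adj hu le_rfl
        omega
      rw [← PMF.mem_support_iff, walk, PMF.mem_support_bind_iff]
      exact ⟨u, (PMF.mem_support_iff _ _).2 (ih u hdu), mem_support_step.2 (Or.inl hu)⟩
  exact ⟨_, h _ x rfl⟩

theorem finite_support_step (G : RootedGraph) (x : G.V) : (G.step x).support.Finite := by
  refine ((G.locallyFinite x).union (Set.finite_singleton x)).subset fun y hy => ?_
  rcases mem_support_step.1 hy with h | ⟨-, h⟩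
  exacts [Or.inl h, Or.inr h]

theorem finite_support_walk (G : RootedGraph) (n : ℕ) : (G.walk n).support.Finite :=
  (G.ball_finite n).subset (G.support_walk_subset_ball n)

theorem entropy_walk_le_log_ncard (G : RootedGraph) (n : ℕ) :
    (G.walk n).entropy ≤ Real.log (G.ball n).ncard := by
  rw [Set.ncard_eq_toFinset_card _ (G.ball_finite n)]
  exact PMF.entropy_le_log_card (by simpa using G.support_walk_subset_ball n)

theorem IsHarmonic.mean_step {G : RootedGraph} {f : G.V → ℝ} (hf : G.IsHarmonic f) (x : G.V) :
    (G.step x).mean f = f x := by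
  by_cases h : (G.nbrs x).Nonempty
  · have hS : (G.step x).support ⊆ G.nbrs x := fun y hy => by
      rcases mem_support_step.1 hy with ha | ⟨h', -⟩
      exacts [mem_nbrs.2 ha, absurd h h']
    rw [PMF.mean_eq_sum hS, hf x, Finset.sum_div]
    refine Finset.sum_congr rfl fun y hy => ?_
    rw [step, dif_pos h, PMF.uniformOfFinset_apply, if_pos hy]
    simp [div_eq_inv_mul]
  · have hS : (G.step x).support ⊆ ({x} : Finset G.V) := fun y hy => by
      rcases mem_support_step.1 hy with ha | ⟨-, rfl⟩
      exacts [absurd ⟨y, mem_nbrs.2 ha⟩ h, by simp]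
    rw [PMF.mean_eq_sum hS, step, dif_neg h]
    simp

theorem IsHarmonic.mean_walk {G : RootedGraph} {f : G.V → ℝ} (hf : G.IsHarmonic f) (n : ℕ) :
    (G.walk n).mean f = f G.root := by
  induction n with
  | zero =>
    rw [PMF.mean_eq_sum (T := {G.root}) (by simp [walk, PMF.support_pure]), walk]
    simp
  | succ n ih =>
    classical
    rw [walk, PMF.mean_bind (S := (G.finite_support_walk n).toFinset)
      (T := (G.finite_support_walk n).toFinset.biUnion
        fun x => (G.finite_support_step x).toFinset) (by simp)]
    · simp only [hf.mean_step, ih]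
    · intro x hx y hy
      exact Finset.mem_coe.2 (Finset.mem_biUnion.2 ⟨x, hx, by simpa using hy⟩)

theorem finite_support_walkFrom (G : RootedGraph) (x : G.V) (n : ℕ) :
    (G.walkFrom x n).support.Finite :=
  (G.reroot x).finite_support_walk n

theorem IsHarmonic.mean_walkFrom {G : RootedGraph} {f : G.V → ℝ} (hf : G.IsHarmonic f) (x : G.V)
    (n : ℕ) : (G.walkFrom x n).mean f = f x :=
  IsHarmonic.mean_walk (G := G.reroot x) hf n

/-- The mutual information of `X_1` and `X_{n+1}` for the walk started at the root, written as the
entropy of `X_{n+1}` minus the mean entropy of `X_{n+1}` given `X_1`. -/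
noncomputable def entropyGain (G : RootedGraph) (n : ℕ) : ℝ :=
  (G.walk (n + 1)).entropy -
    ∑ x ∈ (G.finite_support_step G.root).toFinset,
      (G.step G.root x).toReal * (G.walkFrom x n).entropy

/-- A bounded harmonic function varies little between the root and its neighbours if the entropy
gain is small. -/
theorem sum_step_mul_sq_le_entropyGain {G : RootedGraph} (n : ℕ) {f : G.V → ℝ}
    (hf : G.IsHarmonic f) {M : ℝ} (hM : ∀ v, |f v| ≤ M) :
    ∑ x ∈ (G.finite_support_step G.root).toFinset,
      (G.step G.root x).toReal * (f x - f G.root) ^ 2 ≤ 4 * M ^ 2 * G.entropyGain n := by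
  classical
  have h := PMF.sum_mul_sq_le_entropy_bind_sub (w := G.step G.root)
    (κ := fun x => G.walkFrom x n) (S := (G.finite_support_step G.root).toFinset)
    (T := (G.finite_support_step G.root).toFinset.biUnion
        fun x => (G.finite_support_walkFrom x n).toFinset) (by simp)
    (fun x hx y hy => Finset.mem_coe.2 (Finset.mem_biUnion.2 ⟨x, hx, by simpa using hy⟩)) hM
  simp only [← walk_succ_eq_bind_walkFrom, hf.mean_walk, hf.mean_walkFrom] at h
  exact h

theorem entropyGain_nonneg (G : RootedGraph) (n : ℕ) : 0 ≤ G.entropyGain n := by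
  -- The bound on harmonic functions, applied to `f = 0` with `M = 1`, has left side `0`.
  have h := sum_step_mul_sq_le_entropyGain (G := G) n (f := fun _ => 0) (fun v => by simp)
    (M := 1) (by simp)
  simpa using h

end RootedGraph

/-! ### The space of rooted graphs: local functions and the re-rooting kernel -/

namespace RootedGraphClass
open RootedGraph

theorem ballIso_of_dist_lt {G H : RootedGraph} {r : ℕ}
    (h : dist (mk G) (mk H) < 1 / ((r : ℝ) + 1)) : BallIso G H r := by
  obtain ⟨_, ⟨s, hs, rfl⟩, hlt⟩ := exists_lt_of_csInf_lt (dloc_set_nonempty G H) h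
  refine hs.mono ?_
  have h1 := lt_of_one_div_lt_one_div (by positivity) hlt
  have h2 : (r : ℝ) < s := by linarith
  exact_mod_cast h2.le

theorem isLocallyConstant_of_ballIso {α : Type*} {F : RootedGraphClass → α} (r : ℕ)
    (h : ∀ G H, BallIso G H r → F (mk G) = F (mk H)) : IsLocallyConstant F := by
  rw [IsLocallyConstant.iff_eventually_eq]
  rintro ⟨G⟩
  filter_upwards [Metric.ball_mem_nhds (mk G) (ε := 1 / ((r : ℝ) + 1)) (by positivity)]
  rintro ⟨H⟩ hH
  exact h H G (ballIso_of_dist_lt hH)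

/-- Membership in `U` depends only on the ball of radius `r` about the root. -/
def IsDeterminedByBall (U : Set RootedGraphClass) (r : ℕ) : Prop :=
  ∀ G H, BallIso G H r → (mk G ∈ U ↔ mk H ∈ U)

theorem IsDeterminedByBall.measurableSet {U : Set RootedGraphClass} {r : ℕ}
    (hU : IsDeterminedByBall U r) : MeasurableSet U := by
  have h := (isLocallyConstant_of_ballIso (F := fun c => c ∈ U) r
    fun G H hGH => propext (hU G H hGH)) {True}
  convert h.measurableSet using 1
  ext c
  simp

theorem rerootLaw_mk (n : ℕ) (G : RootedGraph) :
    rerootLaw n (mk G) = (G.walk n).map fun x => mk (G.reroot x) :=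
  rfl

/-- The probability that the walk re-roots the graph at time `n` into a set determined by the ball of
radius `r` depends only on the ball of radius `n + r`. -/
theorem toMeasure_rerootLaw_ballGraph {U : Set RootedGraphClass} {r : ℕ}
    (hU : IsDeterminedByBall U r) (n : ℕ) (G : RootedGraph) :
    (rerootLaw n (mk (G.ballGraph (n + r)))).toMeasure U = (rerootLaw n (mk G)).toMeasure U := by
  rw [PMF.toMeasure_apply_eq_toOuterMeasure_apply _ hU.measurableSet,
    PMF.toMeasure_apply_eq_toOuterMeasure_apply _ hU.measurableSet, rerootLaw_mk, rerootLaw_mk,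
    ← G.map_walk_ballGraph (Nat.le_add_right n r), PMF.map_comp, PMF.toOuterMeasure_map_apply,
    PMF.toOuterMeasure_map_apply]
  refine PMF.toOuterMeasure_apply_eq_of_inter_support_eq _ ?_
  ext x
  refine and_congr_left fun hx => hU _ _ (G.ballIso_reroot_ballGraph x ?_)
  have h1 : G.ballIncl (n + r) x ∈ (G.walk n).support := by
    rw [← G.map_walk_ballGraph (Nat.le_add_right n r), PMF.mem_support_map_iff]
    exact ⟨x, hx, rfl⟩
  exact Nat.add_le_add_right (G.support_walk_subset_ball n h1) r

/-- The re-rooting law is a measurable kernel. It suffices to test open sets. -/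
theorem measurable_toMeasure_rerootLaw (n : ℕ) :
    Measurable fun c => (rerootLaw n c).toMeasure := by
  refine Measurable.measure_of_isPiSystem_of_isProbabilityMeasure
    (BorelSpace.measurable_eq) isPiSystem_isOpen fun U (hU : IsOpen U) => ?_
  -- `D r` is the set of classes for which the ball of radius `r` already forces membership in `U`.
  -- These sets increase to the open set `U`.
  let D : ℕ → Set RootedGraphClass := fun r => {c | ∀ G H, mk G = c → BallIso G H r → mk H ∈ U}
  have hD : ∀ r, IsDeterminedByBall (D r) r := by
    have key : ∀ r G H, BallIso G H r → mk G ∈ D r → mk H ∈ D r := by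
      intro r G H hGH hG H' K hH' hK
      exact hG G K rfl (hGH.trans (((Quotient.exact hH').ballIso r).symm.trans hK))
    exact fun r G H h => ⟨key r G H h, key r H G h.symm⟩
  have hmono : Monotone D := fun r s hrs c hc G H hG hGH => hc G H hG (hGH.mono hrs)
  have hUD : U = ⋃ r, D r := by
    ext c
    rw [Set.mem_iUnion]
    constructor
    · intro hc
      obtain ⟨ε, hε, hball⟩ := Metric.isOpen_iff.1 hU c hc
      obtain ⟨r, hr⟩ := exists_nat_one_div_lt hε
      refine ⟨r, fun G H hG hGH => hball ?_⟩
      rw [← hG, Metric.mem_ball, dist_comm]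
      exact (dloc_le hGH).trans_lt hr
    · rintro ⟨r, hr⟩
      induction c using Quotient.inductionOn with
      | h G => exact hr G G rfl ((Iso.refl G).ballIso r)
  simp only [hUD, hmono.measure_iUnion]
  refine Measurable.iSup fun r => ?_
  refine (isLocallyConstant_of_ballIso (n + r) fun G H hGH => ?_).continuous.measurable
  obtain ⟨e, he⟩ := hGH
  rw [← toMeasure_rerootLaw_ballGraph (hD r) n G, ← toMeasure_rerootLaw_ballGraph (hD r) n H]
  have : mk (G.ballGraph (n + r)) = mk (H.ballGraph (n + r)) := Quotient.sound ⟨e, he⟩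
  rw [this]

theorem lintegral_rerootLaw_mk (n : ℕ) (G : RootedGraph) {g : RootedGraphClass → ℝ≥0∞}
    (hg : Measurable g) :
    ∫⁻ c, g c ∂(rerootLaw n (mk G)).toMeasure = ∑' x, g (mk (G.reroot x)) * G.walk n x := by
  have := G.countable
  let _ : MeasurableSpace G.V := ⊤
  rw [rerootLaw_mk, ← PMF.toMeasure_map _ (G.walk n) measurable_from_top,
    lintegral_map hg measurable_from_top, lintegral_countable']
  refine tsum_congr fun x => ?_
  rw [PMF.toMeasure_apply_singleton _ _ (MeasurableSet.singleton x)]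

/-- The entropy of the walk at time `n`, as a function on `𝒢_•`. It is computed on `G` itself: the
entropy of `rerootLaw n` would be smaller when distinct vertices give isomorphic rooted graphs. -/
noncomputable def walkEntropy (n : ℕ) : RootedGraphClass → ℝ≥0∞ :=
  Quotient.lift (fun G => ENNReal.ofReal (G.walk n).entropy)
    fun _ _ h => by
      simp only [entropy_walk_eq_of_ballIso (Iso.ballIso h n)]

theorem walkEntropy_mk (n : ℕ) (G : RootedGraph) :
    walkEntropy n (mk G) = ENNReal.ofReal (G.walk n).entropy :=
  rfl

theorem measurable_walkEntropy (n : ℕ) : Measurable (walkEntropy n) :=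
  (isLocallyConstant_of_ballIso n fun G H h => by
    rw [walkEntropy_mk, walkEntropy_mk, entropy_walk_eq_of_ballIso h]).continuous.measurable

/-- The entropy gain as a function on `𝒢_•`, expressed through the re-rooting kernel so that it is
visibly measurable. The truncated subtraction does not truncate, by `entropyGain_add`. -/
noncomputable def entropyGain (n : ℕ) (c : RootedGraphClass) : ℝ≥0∞ :=
  walkEntropy (n + 1) c - ∫⁻ c', walkEntropy n c' ∂(rerootLaw 1 c).toMeasure

theorem measurable_lintegral_rerootLaw {g : RootedGraphClass → ℝ≥0∞} (hg : Measurable g) (n : ℕ) :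
    Measurable fun c => ∫⁻ c', g c' ∂(rerootLaw n c).toMeasure :=
  (Measure.measurable_lintegral hg).comp (measurable_toMeasure_rerootLaw n)

theorem measurable_entropyGain (n : ℕ) : Measurable (entropyGain n) :=
  (measurable_walkEntropy (n + 1)).sub
    (measurable_lintegral_rerootLaw (measurable_walkEntropy n) 1)

theorem lintegral_walkEntropy_mk (n : ℕ) (G : RootedGraph) :
    ∫⁻ c, walkEntropy n c ∂(rerootLaw 1 (mk G)).toMeasure =
      ENNReal.ofReal (∑ x ∈ (G.finite_support_step G.root).toFinset,
        (G.step G.root x).toReal * (G.walkFrom x n).entropy) := by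
  have h1 : G.walk 1 = G.step G.root := PMF.pure_bind _ _
  rw [lintegral_rerootLaw_mk 1 G (measurable_walkEntropy n), h1,
    tsum_eq_sum (s := (G.finite_support_step G.root).toFinset),
    ENNReal.ofReal_sum_of_nonneg fun x _ =>
      mul_nonneg ENNReal.toReal_nonneg (G.walkFrom x n).entropy_nonneg]
  · refine Finset.sum_congr rfl fun x _ => ?_
    rw [ENNReal.ofReal_mul ENNReal.toReal_nonneg, ENNReal.ofReal_toReal (PMF.apply_ne_top _ x),
      mul_comm]
    rfl
  · intro x hx
    rw [(PMF.apply_eq_zero_iff _ x).2 fun h => hx ((Set.Finite.mem_toFinset _).2 h), mul_zero]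

theorem entropyGain_mk (n : ℕ) (G : RootedGraph) :
    entropyGain n (mk G) = ENNReal.ofReal (G.entropyGain n) := by
  rw [entropyGain, lintegral_walkEntropy_mk, walkEntropy_mk, RootedGraph.entropyGain,
    ENNReal.ofReal_sub]
  exact Finset.sum_nonneg fun x _ =>
    mul_nonneg ENNReal.toReal_nonneg (G.walkFrom x n).entropy_nonneg

theorem entropyGain_add (n : ℕ) (c : RootedGraphClass) :
    entropyGain n c + ∫⁻ c', walkEntropy n c' ∂(rerootLaw 1 c).toMeasure =
      walkEntropy (n + 1) c := by
  refine tsub_add_cancel_of_le ?_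
  induction c using Quotient.inductionOn with
  | h G =>
    refine (lintegral_walkEntropy_mk n G).trans_le (ENNReal.ofReal_le_ofReal ?_)
    exact sub_nonneg.1 (G.entropyGain_nonneg n)

theorem walkEntropy_le (n : ℕ) (c : RootedGraphClass) :
    walkEntropy n c ≤ ENNReal.ofReal (Real.log (ballCard n c)) := by
  induction c using Quotient.inductionOn with
  | h G => exact ENNReal.ofReal_le_ofReal (G.entropy_walk_le_log_ncard n)

end RootedGraphClass

/-! ### Vanishing entropy gain and the Liouville property -/

theorem RootedGraph.IsHarmonic.eq_root_of_adj {G : RootedGraph} {f : G.V → ℝ}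
    (hf : G.IsHarmonic f) {M : ℝ} (hM : ∀ v, |f v| ≤ M)
    (h : ⨅ n, RootedGraphClass.entropyGain n (RootedGraphClass.mk G) = 0)
    {x : G.V} (hx : G.graph.Adj G.root x) : f x = f G.root := by
  by_contra hne
  have hxs : x ∈ (G.step G.root).support := mem_support_step.2 (Or.inl hx)
  have hw : 0 < (G.step G.root x).toReal :=
    ENNReal.toReal_pos ((PMF.mem_support_iff _ _).1 hxs) (PMF.apply_ne_top _ _)
  have hδ : 0 < (G.step G.root x).toReal * (f x - f G.root) ^ 2 :=
    mul_pos hw (sq_pos_of_ne_zero (sub_ne_zero.2 hne))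
  have hle : ∀ n, (G.step G.root x).toReal * (f x - f G.root) ^ 2 ≤
      4 * M ^ 2 * G.entropyGain n := fun n =>
    (Finset.single_le_sum (f := fun x => (G.step G.root x).toReal * (f x - f G.root) ^ 2)
      (fun _ _ => mul_nonneg ENNReal.toReal_nonneg (sq_nonneg _))
      ((Set.Finite.mem_toFinset _).2 hxs)).trans (sum_step_mul_sq_le_entropyGain n hf hM)
  -- `M ≠ 0`, since otherwise the right side of `hle` would vanish.
  have hM0 : 0 < 4 * M ^ 2 := pos_of_mul_pos_left (hδ.trans_le (hle 0)) (G.entropyGain_nonneg 0)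
  have hlow : ENNReal.ofReal ((G.step G.root x).toReal * (f x - f G.root) ^ 2 / (4 * M ^ 2)) ≤
      ⨅ n, RootedGraphClass.entropyGain n (RootedGraphClass.mk G) := by
    refine le_iInf fun n => ?_
    rw [RootedGraphClass.entropyGain_mk]
    exact ENNReal.ofReal_le_ofReal ((div_le_iff₀' hM0).2 (hle n))
  rw [h, nonpos_iff_eq_zero, ENNReal.ofReal_eq_zero] at hlow
  exact absurd hlow (not_le.2 (div_pos hδ hM0))

theorem RootedGraph.isLiouville_of_forall_iInf_entropyGain {G : RootedGraph}
    (h : ∀ x, ⨅ n, RootedGraphClass.entropyGain n (RootedGraphClass.mk (G.reroot x)) = 0) :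
    G.IsLiouville := by
  rintro f hf ⟨M, hM⟩
  refine ⟨f G.root, fun v => ?_⟩
  have hwalk : ∀ u w (p : G.graph.Walk u w), f u = f w := by
    intro u w p
    induction p with
    | nil => rfl
    | @cons u v w hadj p ih =>
      exact (IsHarmonic.eq_root_of_adj (G := G.reroot u) hf hM (h u) hadj).symm.trans ih
  obtain ⟨p⟩ := G.connected.preconnected v G.root
  exact hwalk _ _ p

/-! ### Stationary random graphs -/

namespace IsStationaryRandomGraph
open RootedGraphClass

variable {Ω : Type*} [MeasurableSpace Ω] {μ : Measure Ω} {X : Ω → RootedGraphClass}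

/-- The law of a stationary random graph is invariant under the re-rooting kernel. -/
theorem bind_rerootLaw (hstat : IsStationaryRandomGraph μ X) (hX : Measurable X) {n : ℕ}
    (hn : 1 ≤ n) : (μ.map X).bind (fun c => (rerootLaw n c).toMeasure) = μ.map X := by
  ext A hA
  rw [Measure.bind_apply hA (measurable_toMeasure_rerootLaw n).aemeasurable,
    Measure.map_apply hX hA, ← hstat n hn A hA]
  exact lintegral_map ((Measure.measurable_coe hA).comp (measurable_toMeasure_rerootLaw n)) hX

theorem lintegral_lintegral_rerootLaw (hstat : IsStationaryRandomGraph μ X) (hX : Measurable X)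
    {n : ℕ} (hn : 1 ≤ n) {g : RootedGraphClass → ℝ≥0∞} (hg : Measurable g) :
    ∫⁻ ω, ∫⁻ c, g c ∂(rerootLaw n (X ω)).toMeasure ∂μ = ∫⁻ ω, g (X ω) ∂μ := by
  rw [← lintegral_map hg hX, ← hstat.bind_rerootLaw hX hn,
    Measure.lintegral_bind (measurable_toMeasure_rerootLaw n).aemeasurable hg.aemeasurable,
    lintegral_map (measurable_lintegral_rerootLaw hg n) hX]

/-- The expected entropy gains telescope. No expectation needs to be finite, because the entropies
are added and never subtracted. -/
theorem sum_lintegral_entropyGain_le (hstat : IsStationaryRandomGraph μ X) (hX : Measurable X)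
    (N : ℕ) : ∑ n ∈ Finset.range N, ∫⁻ ω, entropyGain n (X ω) ∂μ ≤
      ∫⁻ ω, walkEntropy N (X ω) ∂μ := by
  induction N with
  | zero => simp
  | succ N ih =>
    simp only [← entropyGain_add N]
    have hm : Measurable fun ω => entropyGain N (X ω) := (measurable_entropyGain N).comp hX
    rw [lintegral_add_left hm, hstat.lintegral_lintegral_rerootLaw hX le_rfl (measurable_walkEntropy N),
      Finset.sum_range_succ, add_comm]
    gcongr

/-- The infimum has expectation at most the average of the first `N` expected gains, which is at
most `E[log #B(ρ, N)] / N`. -/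
theorem ae_iInf_entropyGain_eq_zero (hstat : IsStationaryRandomGraph μ X) (hX : Measurable X)
    (hgrowth : Tendsto (fun n : ℕ => (n : ℝ≥0∞)⁻¹ * meanLogBall μ X n) atTop (𝓝 0)) :
    ∀ᵐ ω ∂μ, ⨅ n, entropyGain n (X ω) = 0 := by
  have hmeas : Measurable fun ω => ⨅ n, entropyGain n (X ω) :=
    Measurable.iInf fun n => (measurable_entropyGain n).comp hX
  refine (lintegral_eq_zero_iff hmeas).1 (le_antisymm ?_ zero_le)
  refine ge_of_tendsto hgrowth (eventually_atTop.2 ⟨1, fun N hN => ?_⟩)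
  have hN0 : (N : ℝ≥0∞) ≠ 0 := by
    rw [Nat.cast_ne_zero]
    omega
  rw [mul_comm, ← div_eq_mul_inv, ENNReal.le_div_iff_mul_le (Or.inl hN0)
    (Or.inl (ENNReal.natCast_ne_top N)), mul_comm]
  calc (N : ℝ≥0∞) * ∫⁻ ω, ⨅ n, entropyGain n (X ω) ∂μ
      = ∑ n ∈ Finset.range N, ∫⁻ ω, ⨅ n, entropyGain n (X ω) ∂μ := by simp
    _ ≤ ∑ n ∈ Finset.range N, ∫⁻ ω, entropyGain n (X ω) ∂μ :=
      Finset.sum_le_sum fun n _ => lintegral_mono fun ω => iInf_le _ n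
    _ ≤ ∫⁻ ω, walkEntropy N (X ω) ∂μ := hstat.sum_lintegral_entropyGain_le hX N
    _ ≤ meanLogBall μ X N := lintegral_mono fun ω => walkEntropy_le N (X ω)

/-- A null event for a stationary random graph is almost surely not seen from any position of the
walk. -/
theorem ae_forall_rerootLaw_eq_zero (hstat : IsStationaryRandomGraph μ X) (hX : Measurable X)
    {A : Set RootedGraphClass} (hA : MeasurableSet A) (h0 : ∀ᵐ ω ∂μ, X ω ∉ A) :
    ∀ᵐ ω ∂μ, ∀ n, (rerootLaw n (X ω)).toMeasure A = 0 := by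
  have hA0 : μ (X ⁻¹' A) = 0 := by
    simp only [ae_iff, not_not] at h0
    exact h0
  rw [ae_all_iff]
  intro n
  rcases Nat.eq_zero_or_pos n with rfl | hn
  · filter_upwards [h0] with ω hω
    generalize X ω = c at hω
    induction c using Quotient.inductionOn with
    | h G =>
      change (rerootLaw 0 (mk G)).toMeasure A = 0
      rw [rerootLaw_mk, RootedGraph.walk, PMF.pure_map, PMF.toMeasure_pure_apply _ _ hA]
      exact if_neg hω
  · have hm : Measurable fun ω => (rerootLaw n (X ω)).toMeasure A :=
      (Measure.measurable_coe hA).comp ((measurable_toMeasure_rerootLaw n).comp hX)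
    exact (lintegral_eq_zero_iff hm).1 ((hstat n hn A hA).trans hA0)

end IsStationaryRandomGraph

theorem theorem1p1 {Ω : Type*} [MeasurableSpace Ω] (μ : Measure Ω) [IsProbabilityMeasure μ]
    (X : Ω → RootedGraphClass) (hX : Measurable X) (hstat : IsStationaryRandomGraph μ X)
    (hgrowth : Tendsto (fun n : ℕ => (n : ℝ≥0∞)⁻¹ * meanLogBall μ X n) atTop (𝓝 0)) :
    ∀ᵐ ω ∂μ, (X ω).IsLiouville := by
  have hA : MeasurableSet {c | ⨅ n, RootedGraphClass.entropyGain n c = 0}ᶜ :=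
    (Measurable.iInf RootedGraphClass.measurable_entropyGain (measurableSet_singleton 0)).compl
  have h0 := hstat.ae_iInf_entropyGain_eq_zero hX hgrowth
  filter_upwards [hstat.ae_forall_rerootLaw_eq_zero hX hA
    (h0.mono fun ω hω => Set.notMem_compl_iff.2 hω)] with ω hω
  generalize X ω = c at hω
  induction c using Quotient.inductionOn with
  | h G =>
    refine RootedGraph.isLiouville_of_forall_iInf_entropyGain fun x => ?_
    obtain ⟨n, hn⟩ := G.exists_walk_apply_ne_zero x
    by_contra hx
    refine Set.disjoint_left.1 ((PMF.toMeasure_apply_eq_zero_iff _ hA).1 (hω n)) ?_ hx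
    exact (PMF.mem_support_map_iff _ _ _).2 ⟨x, (PMF.mem_support_iff _ _).2 hn, rfl⟩
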